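/- Let $n\ge 2$ and let $\Phi$ be a root system of type $B_n$ with simple roots $\alpha_1,\dots,\alpha_n$ in the Bourbaki numbering, simple coroots $\alpha_1^\vee,\dots,\alpha_n^\vee$ and coroot lattice $R^\vee=\bigoplus_{i=1}^n\mathbb{Z}\alpha_i^\vee$. Let $W$ be its finite Weyl group, generated by the simple reflections $s_i(v)=v-\langle v,\alpha_i\rangle\alpha_i^\vee$ ($1\le i\le n$) acting on the real vector space $V^*=\bigoplus_{i=1}^n\mathbb{R}\alpha_i^\vee$. For $w\in W$ put $$\operatorname{Mod}(w)=(w-\mathrm{Id})R^\vee,\qquad \operatorname{Mov}(w)=\operatorname{Im}(w-\mathrm{Id})=(w-\mathrm{Id})V^*,$$ and say that $w$ *fills its move-set* if $\operatorname{Mod}(w)=\operatorname{Mov}(w)\cap R^\vee$. The conjugacy classes of $W$ are indexed by the pairs $(\beta,\gamma)$ of partitions (possibly empty, with positive parts) $\beta=(\beta_1\ge\dots\ge\beta_p)$ and $\gamma=(\gamma_1\le\dots\le\gamma_q)$ with $|\beta|+|\gamma|=n$: the class indexed by $(\beta,\gamma)$ is that of $w_{\beta,\gamma}=w^\beta_1\cdots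 w^\beta_p\,w^\gamma_1\cdots w^\gamma_q$, where, with $j^\beta_k=\beta_1+\dots+\beta_{k-1}$, $j^\gamma_k=\gamma_1+\dots+\gamma_{k-1}$, $t_0=s_n$ and $t_i=s_{n-i}t_{i-1}s_{n-i}$, $$w^\beta_k=s_{j^\beta_k+1}s_{j^\beta_k+2}\cdots s_{j^\beta_k+\beta_k-1},\qquad w^\gamma_k=t_{j^\gamma_k}\,s_{n-(j^\gamma_k+1)}s_{n-(j^\gamma_k+2)}\cdots s_{n-j^\gamma_{k+1}+1}$$ (a product of simple reflections over an empty range of indices is trivial). Let $w\in W$, and let the conjugacy class of $w$ be indexed by $(\beta,\gamma)$. Then $w$ fills its move-set if and only if one of the following holds: 1. $\beta$ has at least one odd part, and $\gamma$ has exactly one part; 2. $|\gamma|=0$, $\beta_p\ge 2$ and $\gcd(\beta_1,\dots,\beta_p,\beta_p-2)=1$; 3. $|\gamma|=0$ and $\beta_p=1$. -/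

import Mathlib

namespace FillB

/-! ### Representatives of conjugacy classes, as words in simple reflections

In this section `s : ℕ → G` is the list of simple reflections, indexed by `1, …, n`. -/

section Representatives

variable {G : Type*} [Group G]

/-- The positive block of length `l` starting at `j`: the product
`s_{j+1} s_{j+2} ⋯ s_{j+(l-1)}` (trivial if `l = 1`). -/
def posBlock (s : ℕ → G) (j l : ℕ) : G :=
  ((List.range (l - 1)).map fun i => s (j + 1 + i)).prod

/-- The product of the positive blocks of lengths the entries of the list, the first one starting
at `j`, each next one starting where the previous one stops. -/
def posProd (s : ℕ → G) : ℕ → List ℕ → G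
  | _, [] => 1
  | j, l :: ls => posBlock s j l * posProd s (j + l) ls

/-- `t_0 = s_n` and `t_i = s_{n-i} t_{i-1} s_{n-i}` for `1 ≤ i ≤ n - 1`. -/
def tElt (s : ℕ → G) (n : ℕ) : ℕ → G
  | 0 => s n
  | i + 1 => s (n - (i + 1)) * tElt s n i * s (n - (i + 1))

/-- The negative block of length `l` starting at `j`: the product
`t_j s_{n-(j+1)} s_{n-(j+2)} ⋯ s_{n-(j+l)+1}`. -/
def negBlock (s : ℕ → G) (n j l : ℕ) : G :=
  tElt s n j * ((List.range (l - 1)).map fun i => s (n - (j + 1 + i))).prod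

/-- The product of the negative blocks of lengths the entries of the list, the first one starting
at `j`, each next one starting where the previous one stops. -/
def negProd (s : ℕ → G) (n : ℕ) : ℕ → List ℕ → G
  | _, [] => 1
  | j, l :: ls => negBlock s n j l * negProd s n (j + l) ls

/-- The representative `w_{β,γ} = w_β w_γ` attached to the pair of partitions `(β, γ)`. -/
def classRep (s : ℕ → G) (n : ℕ) (β γ : List ℕ) : G :=
  posProd s 0 β * negProd s n 0 γ

end Representatives

/-- `(β, γ)` is a pair of partitions (with positive parts) such that `β` is weakly decreasing, `γ`
is weakly increasing and `|β| + |γ| = n`. -/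
structure IsPartitionPair (n : ℕ) (β γ : List ℕ) : Prop where
  pos_left : ∀ k ∈ β, 1 ≤ k
  pos_right : ∀ k ∈ γ, 1 ≤ k
  decreasing : β.Pairwise (· ≥ ·)
  increasing : γ.Pairwise (· ≤ ·)
  sum_eq : β.sum + γ.sum = n

/-! ### The Weyl group, the coroot lattice, mod-sets and move-sets

In this section `P` is a root system in `M` with coroots in the dual space `N` of `M`, and
`α 0, …, α (n - 1)` are the indices of its simple roots `α_1, …, α_n`. -/

section Weyl

variable {ι M N : Type*} [AddCommGroup M] [Module ℝ M] [AddCommGroup N] [Module ℝ N]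

/-- The finite Weyl group, acting on the space that contains the coroots: the group generated by
the simple reflections `s_i (v) = v - ⟨v, α_i⟩ α_i^∨`. -/
def weylGroup (P : RootPairing ι ℝ M N) {n : ℕ} (α : Fin n → ι) : Subgroup (N ≃ₗ[ℝ] N) :=
  Subgroup.closure (Set.range fun i => P.coreflection (α i))

/-- The simple reflection `s_j`, for `1 ≤ j ≤ n` (the value for other `j` is irrelevant). -/
noncomputable def simpleReflection (P : RootPairing ι ℝ M N) {n : ℕ} (α : Fin n → ι) (j : ℕ) :
    weylGroup P α :=
  if h : 1 ≤ j ∧ j ≤ n then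
    ⟨P.coreflection (α ⟨j - 1, by omega⟩), Subgroup.subset_closure ⟨_, rfl⟩⟩
  else 1

/-- The coroot lattice `R^∨ = ⨁ ℤ α_i^∨`. -/
def corootLattice (P : RootPairing ι ℝ M N) {n : ℕ} (α : Fin n → ι) : Submodule ℤ N :=
  Submodule.span ℤ (Set.range fun i => P.coroot (α i))

/-- The mod-set `Mod(w) = (w - Id) R^∨`. -/
def modSet (P : RootPairing ι ℝ M N) {n : ℕ} (α : Fin n → ι) (w : weylGroup P α) : Set N :=
  {p | ∃ q ∈ corootLattice P α, p = (w : N ≃ₗ[ℝ] N) q - q}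

/-- The move-set `Mov(w) = {p | q + p = w(q) for some q} = Im (w - Id)`. -/
def moveSet (P : RootPairing ι ℝ M N) {n : ℕ} (α : Fin n → ι) (w : weylGroup P α) : Set N :=
  {p | ∃ q : N, q + p = (w : N ≃ₗ[ℝ] N) q}

/-- `w` fills its move-set: `Mod(w) = Mov(w) ∩ R^∨`. -/
def FillsMoveSet (P : RootPairing ι ℝ M N) {n : ℕ} (α : Fin n → ι) (w : weylGroup P α) : Prop :=
  modSet P α w = moveSet P α w ∩ (corootLattice P α : Set N)

/-- The conjugacy class of `w` in the Weyl group is indexed by the pair of partitions `(β, γ)`. -/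
def ClassIndexedBy (P : RootPairing ι ℝ M N) {n : ℕ} (α : Fin n → ι) (w : weylGroup P α)
    (β γ : List ℕ) : Prop :=
  IsPartitionPair n β γ ∧ IsConj w (classRep (simpleReflection P α) n β γ)

end Weyl

end FillB

/-!
In coordinates `ε_1, …, ε_n` in which the simple coroots are `ε_i - ε_{i+1}` (`i < n`) and `2 ε_n`,
the Weyl group acts by signed permutations, the coroot lattice is the lattice `L` of integral
vectors with even sum of entries, and `w_{β,γ}` is a product of disjoint cycles: positive ones of
lengths the parts of `β` and negative ones (whose power by the length is `-1`) of lengths the parts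
of `γ`. Filling the move-set is invariant under conjugation (`FillsMoveSet.of_isConj`), so that the
question is about this signed permutation `w` (`fillsMoveSet_classRep_iff`): when is every vector of
`L` of the form `w q - q`, with `q` real, also of this form with `q ∈ L`? The answer is: when `β` has
an odd part and `γ` has at most one part (`coordFills_classRep_iff`).

* The fixed vectors of `w` are constant on each positive cycle and zero on the negative ones. If all
  parts of `β` are even, an integral fixed vector has even sum, hence no `q ∈ L` has the same move
  as `ε_1`, while `w ε_1 - ε_1 ∈ L` (`exists_odd_of_coordFills`).
* If there are two negative cycles, the vector with entries `1/2` on two of them has its move in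
  `L`, and no integral vector has the same move (`length_le_one_of_coordFills`).
* Conversely, let `w q - q ∈ L`. On a positive cycle the entries of `q` are congruent modulo `ℤ`, and
  subtracting a fixed vector makes them integral. On the negative cycle, if there is one, they are
  congruent to some `c`; the sum of the entries of `w q - q` is then `-2c` up to even integers, which
  forces `c ∈ ℤ` (`exists_coordLattice_of_length_le_one`). If the integral vector so obtained has odd
  sum, adding the indicator of a positive cycle of odd length makes it even.

If `γ` is empty then `β` is not, and the conditions on the last part of `β` express that some part
is odd: either that part is `1`, or it is at least `2` and the gcd is that of the parts and `2`
(`odd_part_and_length_le_one_iff`).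
-/

namespace FillB

/-! ### The signed permutation model -/

/-- The sign change of the `n`-th coordinate. -/
def negCoord (n : ℕ) : (ℕ → ℝ) ≃ₗ[ℝ] (ℕ → ℝ) :=
  LinearEquiv.ofInvolutive
    { toFun := fun f k => if k = n then -f k else f k
      map_add' := fun f g => by ext k; dsimp; split_ifs <;> ring
      map_smul' := fun c f => by ext k; dsimp; split_ifs <;> ring }
    (fun f => by ext k; dsimp; split_ifs <;> ring)

/-- The simple reflections of type `B_n` in coordinates: for `1 ≤ i < n` the `i`-th one exchanges
the coordinates `i` and `i + 1`, and the `n`-th one changes the sign of the `n`-th coordinate.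
Vectors are sequences `ℕ → ℝ` of which only the entries `1, …, n` matter; the value at an index `i`
outside `1, …, n` is the identity, as for `simpleReflection`. -/
def signedSwap (n i : ℕ) : (ℕ → ℝ) ≃ₗ[ℝ] (ℕ → ℝ) :=
  if 1 ≤ i ∧ i ≤ n then
    if i = n then negCoord n else LinearEquiv.funCongrLeft ℝ ℝ (Equiv.swap i (i + 1))
  else 1

lemma signedSwap_apply_of_lt {n i : ℕ} (h1 : 1 ≤ i) (h2 : i < n) (f : ℕ → ℝ) (k : ℕ) :
    signedSwap n i f k = f (if k = i then i + 1 else if k = i + 1 then i else k) := by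
  rw [signedSwap, if_pos ⟨h1, h2.le⟩, if_neg h2.ne]
  simp [LinearEquiv.funCongrLeft_apply, LinearMap.funLeft_apply, Equiv.swap_apply_def]

lemma signedSwap_self_apply {n : ℕ} (h : 1 ≤ n) (f : ℕ → ℝ) (k : ℕ) :
    signedSwap n n f k = if k = n then -f k else f k := by
  rw [signedSwap, if_pos ⟨h, le_rfl⟩, if_pos rfl]
  rfl

/-! ### Blocks in coordinates -/

/-- A positive block sends `ε_{j+1} ↦ ε_{j+2} ↦ ⋯ ↦ ε_{j+l} ↦ ε_{j+1}`. -/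
lemma posBlock_signedSwap_apply {n j l : ℕ} (hl : 1 ≤ l) (h : j + l ≤ n) (f : ℕ → ℝ) (k : ℕ) :
    posBlock (signedSwap n) j l f k =
      f (if k = j + 1 then j + l else if j + 1 < k ∧ k ≤ j + l then k - 1 else k) := by
  induction l, hl using Nat.le_induction generalizing f with
  | base =>
    simp only [posBlock, Nat.sub_self, List.range_zero, List.map_nil, List.prod_nil,
      LinearEquiv.coe_one, id_eq]
    congr 1
    split_ifs <;> omega
  | succ l hl ih =>
    have hstep : posBlock (signedSwap n) j (l + 1) =
        posBlock (signedSwap n) j l * signedSwap n (j + l) := by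
      obtain ⟨m, rfl⟩ : ∃ m, l = m + 1 := ⟨l - 1, by omega⟩
      simp only [posBlock, Nat.add_sub_cancel, List.range_succ, List.map_append, List.map_cons,
        List.map_nil, List.prod_append, List.prod_cons, List.prod_nil, mul_one]
      congr 2
      omega
    rw [hstep, LinearEquiv.mul_apply, ih (by omega),
      signedSwap_apply_of_lt (by omega) (by omega)]
    congr 1
    split_ifs <;> omega

/-- `t_i` is the sign change of the coordinate `n - i`. -/
lemma tElt_signedSwap_apply {n i : ℕ} (h : i < n) (f : ℕ → ℝ) (k : ℕ) :
    tElt (signedSwap n) n i f k = if k = n - i then -f k else f k := by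
  induction i generalizing f k with
  | zero => exact signedSwap_self_apply (by omega) f k
  | succ i ih =>
    rw [tElt, LinearEquiv.mul_apply, LinearEquiv.mul_apply,
      signedSwap_apply_of_lt (by omega) (by omega), ih (by omega),
      signedSwap_apply_of_lt (by omega) (by omega)]
    have e : n - (i + 1) + 1 = n - i := by omega
    rw [e]
    have hne : n - i ≠ n - (i + 1) := by omega
    by_cases h1 : k = n - (i + 1)
    · simp [h1, hne]
    · by_cases h2 : k = n - i
      · simp [h2, hne, hne.symm]
      · simp [h1, h2]

/-- With `m = n - (j + l)`, a negative block sends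
`ε_{m+l} ↦ ε_{m+l-1} ↦ ⋯ ↦ ε_{m+1} ↦ -ε_{m+l}`. -/
lemma negBlock_signedSwap_apply {n j l : ℕ} (hl : 1 ≤ l) (h : j + l ≤ n) (f : ℕ → ℝ) (k : ℕ) :
    negBlock (signedSwap n) n j l f k =
      if k = n - j then -f (n - (j + l) + 1)
      else if n - (j + l) < k ∧ k < n - j then f (k + 1) else f k := by
  induction l, hl using Nat.le_induction generalizing f with
  | base =>
    have e : negBlock (signedSwap n) n j 1 = tElt (signedSwap n) n j := by simp [negBlock]
    rw [e, tElt_signedSwap_apply (by omega)]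
    have e : n - (j + 1) + 1 = n - j := by omega
    rw [e]
    split_ifs with h1 h2
    · rw [h1]
    · omega
    · rfl
  | succ l hl ih =>
    have hstep : negBlock (signedSwap n) n j (l + 1) =
        negBlock (signedSwap n) n j l * signedSwap n (n - (j + l)) := by
      obtain ⟨m, rfl⟩ : ∃ m, l = m + 1 := ⟨l - 1, by omega⟩
      simp only [negBlock, Nat.add_sub_cancel, List.range_succ, List.map_append, List.map_cons,
        List.map_nil, List.prod_append, List.prod_cons, List.prod_nil, mul_one, mul_assoc]
      congr 4
      omega
    rw [hstep, LinearEquiv.mul_apply, ih (by omega)]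
    simp only [signedSwap_apply_of_lt (show 1 ≤ n - (j + l) by omega)
      (show n - (j + l) < n by omega)]
    obtain ⟨m, hm⟩ : ∃ m, n = m + (j + (l + 1)) := ⟨n - (j + (l + 1)), by omega⟩
    have e1 : n - (j + l) = m + 1 := by omega
    have e2 : n - (j + (l + 1)) = m := by omega
    rw [e1, e2]
    by_cases h1 : k = n - j
    · simp only [h1, if_true]
      congr 2
      split_ifs <;> omega
    · simp only [h1, if_false]
      by_cases h2 : m < k ∧ k < n - j
      · rw [if_pos h2]
        split_ifs <;> first | rfl | omega | (congr 1; omega)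
      · rw [if_neg h2, if_neg (by omega)]
        congr 1
        split_ifs <;> omega

/-! ### Products of blocks act within their range -/

lemma posBlock_apply_of_notMem {n j l : ℕ} (hl : 1 ≤ l) (h : j + l ≤ n) (f : ℕ → ℝ) {k : ℕ}
    (hk : k ≤ j ∨ j + l < k) : posBlock (signedSwap n) j l f k = f k := by
  rw [posBlock_signedSwap_apply hl h]
  congr 1
  split_ifs <;> omega

lemma negBlock_apply_of_notMem {n j l : ℕ} (hl : 1 ≤ l) (h : j + l ≤ n) (f : ℕ → ℝ) {k : ℕ}
    (hk : k ≤ n - (j + l) ∨ n - j < k) : negBlock (signedSwap n) n j l f k = f k := by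
  rw [negBlock_signedSwap_apply hl h, if_neg (by omega), if_neg (by omega)]

/-- A positive block fixes the vectors that are constant on it. -/
lemma posBlock_eq_self {n j l : ℕ} (hl : 1 ≤ l) (h : j + l ≤ n) {f : ℕ → ℝ} {c : ℝ}
    (hf : ∀ k, j < k → k ≤ j + l → f k = c) : posBlock (signedSwap n) j l f = f := by
  ext k
  rw [posBlock_signedSwap_apply hl h]
  split_ifs
  · rw [hf _ (by omega) le_rfl, hf _ (by omega) (by omega)]
  · rw [hf _ (by omega) (by omega), hf _ (by omega) (by omega)]
  · rfl

lemma posProd_apply_of_notMem {n : ℕ} {β : List ℕ} (hβ : ∀ l ∈ β, 1 ≤ l) {j : ℕ}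
    (h : j + β.sum ≤ n) (f : ℕ → ℝ) {k : ℕ} (hk : k ≤ j ∨ j + β.sum < k) :
    posProd (signedSwap n) j β f k = f k := by
  induction β generalizing j f with
  | nil => rfl
  | cons l β ih =>
    simp only [List.mem_cons, forall_eq_or_imp, List.sum_cons] at hβ h hk
    rw [posProd, LinearEquiv.mul_apply, posBlock_apply_of_notMem hβ.1 (by omega) _ (by omega),
      ih hβ.2 (by omega) _ (by omega)]

lemma posProd_eq_self_of_eq_zero {n : ℕ} {β : List ℕ} (hβ : ∀ l ∈ β, 1 ≤ l) {j : ℕ}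
    (h : j + β.sum ≤ n) {f : ℕ → ℝ} (hf : ∀ k, j < k → k ≤ j + β.sum → f k = 0) :
    posProd (signedSwap n) j β f = f := by
  induction β generalizing j f with
  | nil => rfl
  | cons l β ih =>
    simp only [List.mem_cons, forall_eq_or_imp, List.sum_cons] at hβ h hf
    rw [posProd, LinearEquiv.mul_apply,
      ih hβ.2 (by omega) fun k h1 h2 => hf k (by omega) (by omega),
      posBlock_eq_self hβ.1 (by omega) fun k h1 h2 => hf k (by omega) (by omega)]

lemma negProd_apply_of_notMem {n : ℕ} {γ : List ℕ} (hγ : ∀ l ∈ γ, 1 ≤ l) {j : ℕ}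
    (h : j + γ.sum ≤ n) (f : ℕ → ℝ) {k : ℕ} (hk : k ≤ n - (j + γ.sum) ∨ n - j < k) :
    negProd (signedSwap n) n j γ f k = f k := by
  induction γ generalizing j f with
  | nil => rfl
  | cons l γ ih =>
    simp only [List.mem_cons, forall_eq_or_imp, List.sum_cons] at hγ h hk
    rw [negProd, LinearEquiv.mul_apply, negBlock_apply_of_notMem hγ.1 (by omega) _ (by omega),
      ih hγ.2 (by omega) _ (by omega)]

lemma negProd_eq_self_of_eq_zero {n : ℕ} {γ : List ℕ} (hγ : ∀ l ∈ γ, 1 ≤ l) {j : ℕ}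
    (h : j + γ.sum ≤ n) {f : ℕ → ℝ} (hf : ∀ k, n - (j + γ.sum) < k → k ≤ n - j → f k = 0) :
    negProd (signedSwap n) n j γ f = f := by
  induction γ generalizing j f with
  | nil => rfl
  | cons l γ ih =>
    simp only [List.mem_cons, forall_eq_or_imp, List.sum_cons] at hγ h hf
    rw [negProd, LinearEquiv.mul_apply,
      ih hγ.2 (by omega) fun k h1 h2 => hf k (by omega) (by omega)]
    ext k
    rw [negBlock_signedSwap_apply hγ.1 (by omega)]
    split_ifs
    · rw [hf k (by omega) (by omega), hf _ (by omega) (by omega), neg_zero]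
    · rw [hf k (by omega) (by omega), hf _ (by omega) (by omega)]
    · rfl

/-! ### Fixed vectors of the blocks -/

/-- Entries of `f` on a positive block are congruent modulo `A` if the block moves `f` by a vector
with entries in `A`. For `A = ℤ` this treats integral moves, for `A = 0` fixed vectors. -/
lemma sub_mem_of_posBlock_sub_mem {n j l : ℕ} (hl : 1 ≤ l) (h : j + l ≤ n) {f : ℕ → ℝ}
    {A : AddSubgroup ℝ}
    (hf : ∀ k, j < k → k ≤ j + l → posBlock (signedSwap n) j l f k - f k ∈ A) {k : ℕ}
    (h1 : j < k) (h2 : k ≤ j + l) : f k - f (j + 1) ∈ A := by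
  induction k, h1 using Nat.le_induction with
  | base => simp
  | succ k hk ih =>
    have := hf (k + 1) (by omega) h2
    rw [posBlock_signedSwap_apply hl h, if_neg (by omega), if_pos (by omega),
      Nat.add_sub_cancel] at this
    simpa using A.sub_mem (ih (by omega)) this

/-- A vector fixed by a product of negative blocks vanishes on them: along a block its entries are
equal, and around the block they change sign. -/
lemma eq_zero_of_negProd_fixed {n : ℕ} {γ : List ℕ} (hγ : ∀ l ∈ γ, 1 ≤ l) {j : ℕ}
    (h : j + γ.sum ≤ n) {f : ℕ → ℝ}
    (hf : ∀ k, n - (j + γ.sum) < k → k ≤ n - j → negProd (signedSwap n) n j γ f k = f k) {k : ℕ}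
    (h1 : n - (j + γ.sum) < k) (h2 : k ≤ n - j) : f k = 0 := by
  induction γ generalizing j k with
  | nil => simp at h1; omega
  | cons l γ ih =>
    simp only [List.mem_cons, forall_eq_or_imp, List.sum_cons] at hγ h hf h1
    have hl := hγ.1
    rcases le_or_gt k (n - (j + l)) with hk | hk
    · refine ih hγ.2 (by omega) (fun i hi1 hi2 => ?_) (by omega) hk
      have := hf i (by omega) (by omega)
      rwa [negProd, LinearEquiv.mul_apply, negBlock_apply_of_notMem hl (by omega) _
        (by omega)] at this
    · have key : ∀ i, n - (j + l) < i → i ≤ n - j →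
          f i = if i = n - j then -f (n - (j + l) + 1) else f (i + 1) := by
        intro i hi1 hi2
        have := hf i (by omega) (by omega)
        rw [negProd, LinearEquiv.mul_apply, negBlock_signedSwap_apply hl (by omega),
          negProd_apply_of_notMem hγ.2 (by omega) _ (by omega)] at this
        rw [← this]
        split_ifs
        · rfl
        · rw [negProd_apply_of_notMem hγ.2 (by omega) _ (by omega)]
        all_goals omega
      have heq : ∀ i, n - (j + l) + 1 ≤ i → i ≤ n - j → f i = f (n - (j + l) + 1) := by
        intro i hi
        induction i, hi using Nat.le_induction with
        | base => simp
        | succ i hi ih' =>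
          intro hi2
          have := key i (by omega) (by omega)
          rw [if_neg (by omega)] at this
          rw [← this, ih' (by omega)]
      have hlast := key (n - j) (by omega) le_rfl
      rw [if_pos rfl, heq _ (by omega) le_rfl] at hlast
      rw [heq k (by omega) h2]
      linarith

/-! ### Indicators of blocks -/

/-- The vector with entries `1` at `j + 1, …, j + l` and `0` elsewhere. -/
def blockVec (j l : ℕ) : ℕ → ℝ := fun k => if j < k ∧ k ≤ j + l then 1 else 0

lemma blockVec_eq_one {j l k : ℕ} (h : j < k ∧ k ≤ j + l) : blockVec j l k = 1 := if_pos h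

lemma blockVec_eq_zero {j l k : ℕ} (h : ¬(j < k ∧ k ≤ j + l)) : blockVec j l k = 0 := if_neg h

/-- The group `ℤ` inside `ℝ`. -/
abbrev intSubgroup : AddSubgroup ℝ := (Int.castAddHom ℝ).range

/-- If `w - 1`, for `w` a product of positive blocks, takes `f` to a vector that is integral on the
blocks, then so is `f` itself up to a fixed vector, a combination of the indicators of the
blocks. -/
lemma exists_posProd_fixed_sub_mem {n : ℕ} {β : List ℕ} (hβ : ∀ l ∈ β, 1 ≤ l) {j : ℕ}
    (h : j + β.sum ≤ n) {f : ℕ → ℝ}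
    (hf : ∀ k, j < k → k ≤ j + β.sum → posProd (signedSwap n) j β f k - f k ∈ intSubgroup) :
    ∃ g : ℕ → ℝ, posProd (signedSwap n) j β g = g ∧
      (∀ k, ¬(j < k ∧ k ≤ j + β.sum) → g k = 0) ∧
      ∀ k, j < k → k ≤ j + β.sum → f k - g k ∈ intSubgroup := by
  induction β generalizing j with
  | nil => exact ⟨0, map_zero _, fun _ _ => rfl, fun k h1 h2 => by simp at h2; omega⟩
  | cons l β ih =>
    simp only [List.mem_cons, forall_eq_or_imp, List.sum_cons] at hβ h hf ⊢
    obtain ⟨g, hg1, hg2, hg3⟩ := ih hβ.2 (j := j + l) (by omega) (fun k h1 h2 => by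
      have := hf k (by omega) (by omega)
      rwa [posProd, LinearEquiv.mul_apply,
        posBlock_apply_of_notMem hβ.1 (by omega) _ (by omega)] at this)
    have hblock : ∀ k, j < k → k ≤ j + l → f k - f (j + 1) ∈ intSubgroup := fun k =>
      sub_mem_of_posBlock_sub_mem hβ.1 (n := n) (by omega) fun k h1 h2 => by
        have := hf k (by omega) (by omega)
        rw [posProd, LinearEquiv.mul_apply, posBlock_signedSwap_apply hβ.1 (by omega),
          posProd_apply_of_notMem hβ.2 (by omega) _ (by split_ifs <;> omega)] at this
        rwa [posBlock_signedSwap_apply hβ.1 (by omega)]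
    refine ⟨f (j + 1) • blockVec j l + g, ?_, fun k hk => ?_, fun k h1 h2 => ?_⟩
    · rw [posProd, LinearEquiv.mul_apply, map_add, hg1, map_smul,
        posProd_eq_self_of_eq_zero hβ.2 (by omega)
          fun k h1 h2 => blockVec_eq_zero (by omega), map_add, map_smul,
        posBlock_eq_self hβ.1 (by omega) fun k h1 h2 => blockVec_eq_one ⟨h1, h2⟩,
        posBlock_eq_self hβ.1 (by omega) fun k h1 h2 => hg2 k (by omega)]
    · simp [blockVec_eq_zero (show ¬(j < k ∧ k ≤ j + l) by omega), hg2 k (by omega)]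
    · rcases le_or_gt k (j + l) with hk | hk
      · simpa [blockVec_eq_one ⟨h1, hk⟩, hg2 k (by omega)] using hblock k h1 hk
      · simpa [blockVec_eq_zero (show ¬(j < k ∧ k ≤ j + l) by omega)] using
          hg3 k hk (by omega)

lemma exists_posProd_fixed_blockVec {n : ℕ} {β : List ℕ} (hβ : ∀ l ∈ β, 1 ≤ l) {j : ℕ}
    (h : j + β.sum ≤ n) {l : ℕ} (hl : l ∈ β) :
    ∃ i, j ≤ i ∧ i + l ≤ j + β.sum ∧
      posProd (signedSwap n) j β (blockVec i l) = blockVec i l := by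
  induction β generalizing j with
  | nil => simp at hl
  | cons m β ih =>
    simp only [List.mem_cons, forall_eq_or_imp, List.sum_cons] at hβ h hl ⊢
    rcases hl with rfl | hl
    · refine ⟨j, le_rfl, by omega, ?_⟩
      rw [posProd, LinearEquiv.mul_apply, posProd_eq_self_of_eq_zero hβ.2 (by omega)
        fun k h1 h2 => blockVec_eq_zero (by omega),
        posBlock_eq_self hβ.1 (by omega) fun k h1 h2 => blockVec_eq_one ⟨h1, h2⟩]
    · obtain ⟨i, h1, h2, h3⟩ := ih hβ.2 (j := j + m) (by omega) hl
      refine ⟨i, by omega, by omega, ?_⟩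
      rw [posProd, LinearEquiv.mul_apply, h3,
        posBlock_eq_self hβ.1 (by omega) fun k h1 h2 => blockVec_eq_zero (by omega)]

/-- The sum of a fixed integral vector over blocks of even lengths is even, as it is constant on
each of them. -/
lemma sum_even_of_posProd_fixed {n : ℕ} {β : List ℕ} (hβ : ∀ l ∈ β, 1 ≤ l)
    (heven : ∀ l ∈ β, Even l) {j : ℕ} (h : j + β.sum ≤ n) {f : ℕ → ℝ}
    (hint : ∀ k, f k ∈ intSubgroup)
    (hf : ∀ k, j < k → k ≤ j + β.sum → posProd (signedSwap n) j β f k = f k) :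
    ∃ z : ℤ, ∑ k ∈ Finset.Ioc j (j + β.sum), f k = 2 * z := by
  induction β generalizing j with
  | nil => exact ⟨0, by simp⟩
  | cons l β ih =>
    simp only [List.mem_cons, forall_eq_or_imp, List.sum_cons] at hβ heven h hf ⊢
    obtain ⟨z, hz⟩ := ih hβ.2 heven.2 (j := j + l) (by omega) (fun k h1 h2 => by
      have := hf k (by omega) (by omega)
      rwa [posProd, LinearEquiv.mul_apply,
        posBlock_apply_of_notMem hβ.1 (by omega) _ (by omega)] at this)
    have hblock : ∀ k ∈ Finset.Ioc j (j + l), f k = f (j + 1) := fun k hk => by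
      rw [Finset.mem_Ioc] at hk
      refine sub_eq_zero.mp <| AddSubgroup.mem_bot.mp <|
        sub_mem_of_posBlock_sub_mem hβ.1 (n := n) (by omega) (fun k h1 h2 => ?_) hk.1 hk.2
      have := hf k (by omega) (by omega)
      rw [posProd, LinearEquiv.mul_apply, posBlock_signedSwap_apply hβ.1 (by omega),
        posProd_apply_of_notMem hβ.2 (by omega) _ (by split_ifs <;> omega)] at this
      rw [posBlock_signedSwap_apply hβ.1 (by omega), this, sub_self]
      exact AddSubgroup.zero_mem _
    obtain ⟨m, hm⟩ := heven.1
    obtain ⟨y, hy⟩ := hint (j + 1)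
    refine ⟨m * y + z, ?_⟩
    rw [← Finset.sum_Ioc_consecutive _ (show j ≤ j + l by omega)
      (show j + l ≤ j + (l + β.sum) by omega), Finset.sum_congr rfl hblock, ← add_assoc, hz,
      Finset.sum_const, Nat.card_Ioc, ← hy, hm]
    simp
    ring

/-! ### The lattice of integral vectors and its even sublattice -/

/-- The lattice `ℤ^n`: vectors with integral entries, zero outside the positions `1, …, n`. -/
def coordLattice (n : ℕ) : AddSubgroup (ℕ → ℝ) where
  carrier := {f | (∀ k, f k ∈ intSubgroup) ∧ ∀ k, ¬(0 < k ∧ k ≤ n) → f k = 0}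
  zero_mem' := ⟨fun _ => intSubgroup.zero_mem, fun _ _ => rfl⟩
  add_mem' := fun ha hb => ⟨fun k => intSubgroup.add_mem (ha.1 k) (hb.1 k),
    fun k hk => by simp [ha.2 k hk, hb.2 k hk]⟩
  neg_mem' := fun ha => ⟨fun k => intSubgroup.neg_mem (ha.1 k), fun k hk => by simp [ha.2 k hk]⟩

/-- The vectors of `ℤ^n` with even sum of entries: the coroot lattice of type `B_n` in
coordinates. -/
def evenLattice (n : ℕ) : AddSubgroup (ℕ → ℝ) where
  carrier := {f | f ∈ coordLattice n ∧ ∃ z : ℤ, ∑ k ∈ Finset.Ioc 0 n, f k = 2 * z}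
  zero_mem' := ⟨zero_mem _, 0, by simp⟩
  add_mem' := by
    rintro f g ⟨hf, y, hy⟩ ⟨hg, z, hz⟩
    refine ⟨add_mem hf hg, y + z, ?_⟩
    simp only [Pi.add_apply, Finset.sum_add_distrib, hy, hz]
    push_cast
    ring
  neg_mem' := by
    rintro f ⟨hf, y, hy⟩
    refine ⟨neg_mem hf, -y, ?_⟩
    simp only [Pi.neg_apply, Finset.sum_neg_distrib, hy]
    push_cast
    ring

lemma intCast_mem_intSubgroup (z : ℤ) : (z : ℝ) ∈ intSubgroup := ⟨z, rfl⟩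

lemma mul_mem_intSubgroup {x y : ℝ} (hx : x ∈ intSubgroup) (hy : y ∈ intSubgroup) :
    x * y ∈ intSubgroup := by
  obtain ⟨a, rfl⟩ := hx
  obtain ⟨b, rfl⟩ := hy
  exact ⟨a * b, by simp⟩

lemma single_mem_coordLattice {n i : ℕ} (h1 : 1 ≤ i) (h2 : i ≤ n) :
    (Pi.single i 1 : ℕ → ℝ) ∈ coordLattice n := by
  refine ⟨fun k => ?_, fun k hk => Pi.single_eq_of_ne (by omega) _⟩
  rw [Pi.single_apply]
  split_ifs
  · exact ⟨1, by simp⟩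
  · exact zero_mem _

lemma sum_single {n i : ℕ} (h1 : 1 ≤ i) (h2 : i ≤ n) :
    ∑ k ∈ Finset.Ioc 0 n, (Pi.single i 1 : ℕ → ℝ) k = 1 := by
  rw [Finset.sum_pi_single', if_pos (Finset.mem_Ioc.mpr ⟨h1, h2⟩)]

lemma blockVec_mem_coordLattice {n j l : ℕ} (h : j + l ≤ n) : blockVec j l ∈ coordLattice n := by
  refine ⟨fun k => ?_, fun k hk => blockVec_eq_zero (by omega)⟩
  rw [blockVec]
  split_ifs
  · exact ⟨1, by simp⟩
  · exact zero_mem _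

lemma sum_blockVec {n j l : ℕ} (h : j + l ≤ n) :
    ∑ k ∈ Finset.Ioc 0 n, blockVec j l k = l := by
  have : (Finset.Ioc 0 n).filter (fun k => j < k ∧ k ≤ j + l) = Finset.Ioc j (j + l) := by
    ext k
    simp only [Finset.mem_filter, Finset.mem_Ioc]
    omega
  simp [blockVec, this]

/-- The `i`-th simple coroot in coordinates: `ε_i - ε_{i+1}` if `i ≠ n`, and `2 ε_n` if `i = n`. -/
def corootVec (n i : ℕ) : ℕ → ℝ :=
  if i = n then (2 : ℝ) • Pi.single n 1 else Pi.single i 1 - Pi.single (i + 1) 1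

/-- The `i`-th simple root in coordinates, as a linear form. -/
def rootForm (n i : ℕ) : (ℕ → ℝ) →ₗ[ℝ] ℝ :=
  let p : ℕ → (ℕ → ℝ) →ₗ[ℝ] ℝ := LinearMap.proj
  if i = n then p n else p i - p (i + 1)

lemma rootForm_apply (n i : ℕ) (f : ℕ → ℝ) :
    rootForm n i f = if i = n then f n else f i - f (i + 1) := by
  rw [rootForm]
  split_ifs <;> rfl

lemma corootVec_mem_evenLattice {n i : ℕ} (h1 : 1 ≤ i) (h2 : i ≤ n) :
    corootVec n i ∈ evenLattice n := by
  rw [corootVec]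
  split_ifs with h
  · rw [two_smul]
    refine ⟨add_mem (single_mem_coordLattice (by omega) le_rfl)
      (single_mem_coordLattice (by omega) le_rfl), 1, ?_⟩
    simp only [Pi.add_apply, Finset.sum_add_distrib, sum_single (show 1 ≤ n by omega) le_rfl]
    norm_num
  · refine ⟨sub_mem (single_mem_coordLattice h1 h2) (single_mem_coordLattice (by omega)
      (by omega)), 0, ?_⟩
    simp only [Pi.sub_apply, Finset.sum_sub_distrib, sum_single h1 h2,
      sum_single (show 1 ≤ i + 1 by omega) (show i + 1 ≤ n by omega)]
    norm_num

lemma signedSwap_apply_eq_sub {n i : ℕ} (h1 : 1 ≤ i) (h2 : i ≤ n) (f : ℕ → ℝ) :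
    signedSwap n i f = f - rootForm n i f • corootVec n i := by
  ext k
  rcases h2.eq_or_lt with rfl | h2
  · rw [signedSwap_self_apply h1]
    by_cases hk : k = i
    · subst hk
      simp [rootForm_apply, corootVec]
      ring
    · simp [rootForm_apply, corootVec, hk]
  · rw [signedSwap_apply_of_lt h1 h2]
    by_cases hk : k = i
    · subst hk
      simp [rootForm_apply, corootVec, h2.ne]
    · by_cases hk' : k = i + 1
      · subst hk'
        simp [rootForm_apply, corootVec, h2.ne]
      · simp [rootForm_apply, corootVec, h2.ne, hk, hk']

lemma rootForm_mem_intSubgroup {n i : ℕ} {f : ℕ → ℝ} (hf : ∀ k, f k ∈ intSubgroup) :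
    rootForm n i f ∈ intSubgroup := by
  rw [rootForm_apply]
  split_ifs
  · exact hf n
  · exact sub_mem (hf i) (hf (i + 1))

lemma smul_mem_evenLattice {n : ℕ} {f : ℕ → ℝ} (hf : f ∈ evenLattice n) {c : ℝ}
    (hc : c ∈ intSubgroup) : c • f ∈ evenLattice n := by
  obtain ⟨z, rfl⟩ := hc
  simpa [Int.cast_smul_eq_zsmul] using zsmul_mem hf z

/-! ### Words in the simple reflections -/

section Words

variable {G : Type*} [Group G]

lemma classRep_mem (H : Submonoid G) {s : ℕ → G} (hs : ∀ i, s i ∈ H) (n : ℕ) (β γ : List ℕ) :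
    classRep s n β γ ∈ H := by
  have hlist : ∀ (u : ℕ → ℕ) (m : ℕ), ((List.range m).map fun i => s (u i)).prod ∈ H :=
    fun u m => H.list_prod_mem fun x hx => by
      obtain ⟨i, -, rfl⟩ := List.mem_map.mp hx
      exact hs _
  have ht : ∀ i, tElt s n i ∈ H := fun i => by
    induction i with
    | zero => exact hs n
    | succ i ih => exact H.mul_mem (H.mul_mem (hs _) ih) (hs _)
  have hpos : ∀ j, posProd s j β ∈ H := by
    induction β with
    | nil => exact fun _ => H.one_mem
    | cons l β ih => exact fun j => H.mul_mem (hlist _ _) (ih _)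
  have hneg : ∀ j, negProd s n j γ ∈ H := by
    induction γ with
    | nil => exact fun _ => H.one_mem
    | cons l γ ih => exact fun j => H.mul_mem (H.mul_mem (ht _) (hlist _ _)) (ih _)
  exact H.mul_mem (hpos 0) (hneg 0)

lemma map_classRep {G' : Type*} [Group G'] (φ : G →* G') (s : ℕ → G) (n : ℕ) (β γ : List ℕ) :
    φ (classRep s n β γ) = classRep (fun i => φ (s i)) n β γ := by
  have ht : ∀ i, φ (tElt s n i) = tElt (fun i => φ (s i)) n i := fun i => by
    induction i with
    | zero => rfl
    | succ i ih => simp [tElt, ih]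
  have hpos : ∀ j, φ (posProd s j β) = posProd (fun i => φ (s i)) j β := by
    induction β with
    | nil => exact fun _ => map_one φ
    | cons l β ih => simp [posProd, posBlock, ih, map_list_prod, Function.comp_def]
  have hneg : ∀ j, φ (negProd s n j γ) = negProd (fun i => φ (s i)) n j γ := by
    induction γ with
    | nil => exact fun _ => map_one φ
    | cons l γ ih => simp [negProd, negBlock, ih, ht, map_list_prod, Function.comp_def]
  rw [classRep, map_mul, hpos, hneg, classRep]

end Words

/-- The signed permutations move integral vectors by elements of the coroot lattice. -/
lemma classRep_signedSwap_sub_mem {n : ℕ} (β γ : List ℕ) {f : ℕ → ℝ} (hf : f ∈ coordLattice n) :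
    classRep (signedSwap n) n β γ f - f ∈ evenLattice n := by
  let H : Submonoid ((ℕ → ℝ) ≃ₗ[ℝ] (ℕ → ℝ)) :=
    { carrier := {T | ∀ f ∈ coordLattice n, T f - f ∈ evenLattice n}
      one_mem' := fun f _ => by simp
      mul_mem' := fun {S T} hS hT f hf => by
        have hTf : T f ∈ coordLattice n := by simpa using add_mem (hT f hf).1 hf
        simpa using add_mem (hS _ hTf) (hT f hf) }
  refine classRep_mem H (fun i f hf => ?_) n β γ f hf
  by_cases hi : 1 ≤ i ∧ i ≤ n
  · rw [signedSwap_apply_eq_sub hi.1 hi.2, sub_sub_cancel_left]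
    exact neg_mem (smul_mem_evenLattice (corootVec_mem_evenLattice hi.1 hi.2)
      (rootForm_mem_intSubgroup hf.1))
  · simp [signedSwap, hi]

/-! ### The criterion in coordinates -/

section Criterion

variable {n : ℕ} {β γ : List ℕ}

/-- The positive and the negative blocks act on complementary sets of coordinates. -/
lemma classRep_signedSwap_apply (hp : IsPartitionPair n β γ) (f : ℕ → ℝ) :
    classRep (signedSwap n) n β γ f =
      posProd (signedSwap n) 0 β f + negProd (signedSwap n) n 0 γ f - f := by
  have hs := hp.sum_eq
  have key : posProd (signedSwap n) 0 β (negProd (signedSwap n) n 0 γ f - f) =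
      negProd (signedSwap n) n 0 γ f - f :=
    posProd_eq_self_of_eq_zero hp.pos_left (by omega) fun k h1 h2 => by
      rw [Pi.sub_apply, negProd_apply_of_notMem hp.pos_right (by omega) _ (by omega), sub_self]
  rw [map_sub] at key
  rw [classRep, LinearEquiv.mul_apply, eq_add_of_sub_eq key]
  abel

lemma classRep_signedSwap_apply_of_le (hp : IsPartitionPair n β γ) (f : ℕ → ℝ) {k : ℕ}
    (hk : k ≤ β.sum) : classRep (signedSwap n) n β γ f k = posProd (signedSwap n) 0 β f k := by
  have hs := hp.sum_eq
  rw [classRep_signedSwap_apply hp, Pi.sub_apply, Pi.add_apply,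
    negProd_apply_of_notMem hp.pos_right (by omega) _ (by omega), add_sub_cancel_right]

lemma classRep_signedSwap_apply_of_gt (hp : IsPartitionPair n β γ) (f : ℕ → ℝ) {k : ℕ}
    (hk : β.sum < k) :
    classRep (signedSwap n) n β γ f k = negProd (signedSwap n) n 0 γ f k := by
  have hs := hp.sum_eq
  rw [classRep_signedSwap_apply hp, Pi.sub_apply, Pi.add_apply,
    posProd_apply_of_notMem hp.pos_left (by omega) _ (by omega), add_sub_cancel_left]

lemma classRep_eq_self_of_posProd_fixed (hp : IsPartitionPair n β γ) {f : ℕ → ℝ}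
    (hf : posProd (signedSwap n) 0 β f = f) (h0 : ∀ k, ¬(0 < k ∧ k ≤ β.sum) → f k = 0) :
    classRep (signedSwap n) n β γ f = f := by
  have hs := hp.sum_eq
  rw [classRep_signedSwap_apply hp, hf, negProd_eq_self_of_eq_zero hp.pos_right (by omega)
    fun k h1 h2 => h0 k (by omega), add_sub_cancel_right]

lemma eq_zero_of_classRep_fixed (hp : IsPartitionPair n β γ) {f : ℕ → ℝ}
    (hf : classRep (signedSwap n) n β γ f = f) {k : ℕ} (h1 : β.sum < k) (h2 : k ≤ n) :
    f k = 0 := by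
  have hs := hp.sum_eq
  refine eq_zero_of_negProd_fixed hp.pos_right (n := n) (j := 0) (by omega) (fun i hi1 hi2 => ?_)
    (by omega) (by omega)
  rw [← classRep_signedSwap_apply_of_gt hp f (by omega), hf]

/-- `T` fills its move-set, in coordinates: every move in the even lattice of a vector of `ℝ^n` is
the move of a vector of the even lattice. -/
def CoordFills (n : ℕ) (T : (ℕ → ℝ) ≃ₗ[ℝ] (ℕ → ℝ)) : Prop :=
  ∀ f : ℕ → ℝ, (∀ k, ¬(0 < k ∧ k ≤ n) → f k = 0) → T f - f ∈ evenLattice n →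
    ∃ g ∈ evenLattice n, T g - g = T f - f

/-- If all positive cycles have even length then integral fixed vectors have even sum, and the move
of `ε_1` is not that of a vector of even sum. -/
lemma exists_odd_of_coordFills (hn : 1 ≤ n) (hp : IsPartitionPair n β γ)
    (h : CoordFills n (classRep (signedSwap n) n β γ)) : ∃ l ∈ β, Odd l := by
  by_contra! hodd
  have hs := hp.sum_eq
  have hf : (Pi.single 1 1 : ℕ → ℝ) ∈ coordLattice n := single_mem_coordLattice le_rfl hn
  obtain ⟨g, ⟨hg, y, hy⟩, hgf⟩ := h _ hf.2 (classRep_signedSwap_sub_mem β γ hf)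
  have hfix : classRep (signedSwap n) n β γ (g - Pi.single 1 1) = g - Pi.single 1 1 := by
    rw [map_sub]
    linear_combination (exp := 1) hgf
  obtain ⟨z, hz⟩ := sum_even_of_posProd_fixed hp.pos_left
    (fun l hl => Nat.not_odd_iff_even.mp (hodd l hl)) (n := n) (j := 0) (by omega)
    (sub_mem hg hf).1 fun k h1 h2 => by
      rw [← classRep_signedSwap_apply_of_le hp _ (by omega), hfix]
  have hsum : ∑ k ∈ Finset.Ioc 0 n, (g - Pi.single 1 1 : ℕ → ℝ) k = 2 * z := by
    rw [← Finset.sum_Ioc_consecutive _ (Nat.zero_le _) (show 0 + β.sum ≤ n by omega), hz,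
      Finset.sum_eq_zero, add_zero]
    intro k hk
    rw [Finset.mem_Ioc] at hk
    exact eq_zero_of_classRep_fixed hp hfix (by omega) hk.2
  simp only [Pi.sub_apply, Finset.sum_sub_distrib, hy, sum_single le_rfl hn] at hsum
  have : 2 * y - 1 = 2 * z := by exact_mod_cast hsum
  omega

/-- With two negative cycles, the vector whose entries are `1/2` on both of them is moved by the
even vector `-ε_i - ε_j`, and it is the only vector with this move up to the positive cycles. -/
lemma length_le_one_of_coordFills (hp : IsPartitionPair n β γ)
    (h : CoordFills n (classRep (signedSwap n) n β γ)) : γ.length ≤ 1 := by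
  by_contra! hlen
  have hs := hp.sum_eq
  obtain ⟨a, b, γ, rfl⟩ : ∃ a b γ', γ = a :: b :: γ' := by
    match γ, hlen with
    | a :: b :: γ', _ => exact ⟨a, b, γ', rfl⟩
  have hpr := hp.pos_right
  simp only [List.mem_cons, forall_eq_or_imp, List.sum_cons] at hpr hs
  obtain ⟨ha, hb, hγ⟩ := hpr
  set f : ℕ → ℝ := (1 / 2 : ℝ) • blockVec (n - (a + b)) (a + b) with hf
  have hf1 : ∀ k, n - (a + b) < k → k ≤ n → f k = 1 / 2 := fun k h1 h2 => by
    simp [hf, blockVec_eq_one (show n - (a + b) < k ∧ k ≤ n - (a + b) + (a + b) by omega)]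
  have hf0 : ∀ k, k ≤ n - (a + b) ∨ n < k → f k = 0 := fun k hk => by
    simp [hf, blockVec_eq_zero (show ¬(n - (a + b) < k ∧ k ≤ n - (a + b) + (a + b)) by omega)]
  have hmove : classRep (signedSwap n) n β (a :: b :: γ) f - f =
      -(Pi.single n 1 + Pi.single (n - a) 1) := by
    rw [classRep_signedSwap_apply hp, posProd_eq_self_of_eq_zero hp.pos_left (by omega)
      fun k h1 h2 => hf0 k (by omega), add_sub_cancel_left, negProd, negProd,
      LinearEquiv.mul_apply, LinearEquiv.mul_apply, negProd_eq_self_of_eq_zero hγ (by omega)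
      fun k h1 h2 => hf0 k (by omega)]
    have hinner : negBlock (signedSwap n) n (0 + a) b f = f - Pi.single (n - a) 1 := by
      ext k
      rw [negBlock_signedSwap_apply hb (by omega), Pi.sub_apply]
      by_cases h1 : k = n - a
      · rw [if_pos (by omega), h1, hf1 _ (by omega) (by omega), hf1 _ (by omega) (by omega),
          Pi.single_eq_same]
        norm_num
      · rw [Pi.single_eq_of_ne h1, if_neg (by omega), sub_zero]
        split_ifs
        · rw [hf1 _ (by omega) (by omega), hf1 _ (by omega) (by omega)]
        · rfl
    rw [hinner]
    ext k
    rw [Pi.sub_apply, negBlock_signedSwap_apply ha (by omega), Pi.neg_apply, Pi.add_apply]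
    by_cases h1 : k = n
    · rw [if_pos (by omega), h1, Pi.sub_apply, hf1 _ (by omega) (by omega),
        hf1 _ (by omega) (by omega), Pi.single_eq_same, Pi.single_eq_of_ne (by omega),
        Pi.single_eq_of_ne (by omega)]
      norm_num
    · rw [Pi.single_eq_of_ne h1, if_neg (by omega)]
      split_ifs
      · rw [Pi.sub_apply, hf1 _ (by omega) (by omega), hf1 _ (by omega) (by omega),
          Pi.single_eq_of_ne (by omega), Pi.single_eq_of_ne (by omega)]
        norm_num
      · rw [Pi.sub_apply]
        ring
  obtain ⟨g, ⟨hg, -⟩, hgf⟩ := h f (fun k hk => hf0 k (by omega)) (by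
    rw [hmove]
    refine neg_mem ⟨add_mem (single_mem_coordLattice (by omega) le_rfl)
      (single_mem_coordLattice (by omega) (by omega)), 1, ?_⟩
    simp only [Pi.add_apply, Finset.sum_add_distrib, sum_single (show 1 ≤ n by omega) le_rfl,
      sum_single (show 1 ≤ n - a by omega) (show n - a ≤ n by omega)]
    norm_num)
  have hfix : classRep (signedSwap n) n β (a :: b :: γ) (g - f) = g - f := by
    rw [map_sub]
    linear_combination (exp := 1) hgf
  have hgn := eq_zero_of_classRep_fixed hp hfix (k := n) (by omega) le_rfl
  rw [Pi.sub_apply, hf1 n (by omega) le_rfl, sub_eq_zero] at hgn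
  obtain ⟨z, hz⟩ := hg.1 n
  rw [hgn] at hz
  have : 2 * z = 1 := by
    have : (2 * z : ℝ) = 1 := by
      simp at hz
      linarith
    exact_mod_cast this
  omega

/-- With at most one negative cycle, a vector moved by an element of the even lattice is integral
up to a fixed vector: its entries on the negative cycle are congruent to some `c` modulo `ℤ`, and
the sum of the entries of its move is `-2c` up to even integers, so that `c` is an integer. -/
lemma exists_coordLattice_of_length_le_one (hp : IsPartitionPair n β γ) (hγ : γ.length ≤ 1)
    {f : ℕ → ℝ} (hf0 : ∀ k, ¬(0 < k ∧ k ≤ n) → f k = 0)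
    (hf : classRep (signedSwap n) n β γ f - f ∈ evenLattice n) :
    ∃ g ∈ coordLattice n,
      classRep (signedSwap n) n β γ g - g = classRep (signedSwap n) n β γ f - f := by
  have hs := hp.sum_eq
  obtain ⟨g, hg, hg0, hgi⟩ := exists_posProd_fixed_sub_mem hp.pos_left (n := n) (j := 0) (f := f)
    (by omega) fun k h1 h2 => by
      rw [← classRep_signedSwap_apply_of_le hp _ (by omega)]
      exact hf.1.1 k
  rw [zero_add] at hg0 hgi
  have hfg : classRep (signedSwap n) n β γ (f - g) - (f - g) =
      classRep (signedSwap n) n β γ f - f := by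
    rw [map_sub, classRep_eq_self_of_posProd_fixed hp hg hg0]
    abel
  refine ⟨f - g, ⟨fun k => ?_, fun k hk => ?_⟩, hfg⟩
  swap
  · rw [Pi.sub_apply, hf0 k hk, hg0 k (by omega), sub_zero]
  rw [← hfg] at hf
  have hout : ∀ k, ¬(0 < k ∧ k ≤ n) → (f - g) k = 0 := fun k hk => by
    rw [Pi.sub_apply, hf0 k hk, hg0 k (by omega), sub_zero]
  have hin : ∀ k, 0 < k → k ≤ β.sum → (f - g) k ∈ intSubgroup := hgi
  generalize f - g = f at hf hout hin
  match γ, hγ with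
  | [], _ =>
    by_cases hk : 0 < k ∧ k ≤ n
    · exact hin k hk.1 (by simp at hs; omega)
    · rw [hout k hk]
      exact zero_mem _
  | [l], _ =>
    have hl : 1 ≤ l := hp.pos_right l (by simp)
    rw [List.sum_singleton] at hs
    have hneg : negProd (signedSwap n) n 0 [l] = negBlock (signedSwap n) n 0 l := by
      simp [negProd]
    have hn : n - (0 + l) = β.sum := by omega
    have hcong : ∀ i, β.sum + 1 ≤ i → i ≤ n → f i - f (β.sum + 1) ∈ intSubgroup := by
      intro i hi
      induction i, hi using Nat.le_induction with
      | base => simp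
      | succ i hi ih =>
        intro hi2
        have := hf.1.1 i
        rw [Pi.sub_apply, classRep_signedSwap_apply_of_gt hp _ (by omega), hneg,
          negBlock_signedSwap_apply hl (by omega), if_neg (by omega), if_pos (by omega)] at this
        simpa using add_mem this (ih (by omega))
    set c := f (β.sum + 1)
    have hd : f - c • blockVec β.sum l ∈ coordLattice n := by
      refine ⟨fun i => ?_, fun i hi => ?_⟩
      · by_cases hi : β.sum < i ∧ i ≤ β.sum + l
        · simpa [blockVec_eq_one hi] using hcong i hi.1 (by omega)
        · simp only [Pi.sub_apply, Pi.smul_apply, blockVec_eq_zero hi, smul_zero, sub_zero]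
          by_cases hi' : 0 < i ∧ i ≤ n
          · exact hin i hi'.1 (by omega)
          · rw [hout i hi']
            exact zero_mem _
      · simp [blockVec_eq_zero (show ¬(β.sum < i ∧ i ≤ β.sum + l) by omega), hout i hi]
    have hmove : classRep (signedSwap n) n β [l] (blockVec β.sum l) - blockVec β.sum l =
        (-2 : ℝ) • Pi.single n 1 := by
      rw [classRep_signedSwap_apply hp, posProd_eq_self_of_eq_zero hp.pos_left (by omega)
        fun k h1 h2 => blockVec_eq_zero (by omega), add_sub_cancel_left, hneg]
      ext i
      rw [Pi.sub_apply, negBlock_signedSwap_apply hl (by omega), hn, Pi.smul_apply]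
      by_cases h1 : i = n
      · rw [if_pos (by omega), h1, Pi.single_eq_same, blockVec_eq_one (by omega),
          blockVec_eq_one (by omega)]
        norm_num
      · rw [Pi.single_eq_of_ne h1, if_neg (by omega)]
        split_ifs
        · rw [blockVec_eq_one (by omega), blockVec_eq_one (by omega)]
          norm_num
        · simp
    have hc : c • ((-2 : ℝ) • (Pi.single n 1 : ℕ → ℝ)) ∈ evenLattice n := by
      have := sub_mem hf (classRep_signedSwap_sub_mem β [l] hd)
      rw [← hmove]
      convert this using 1
      rw [map_sub, map_smul, smul_sub]
      abel
    obtain ⟨-, z, hz⟩ := hc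
    have hcz : c = ((-z : ℤ) : ℝ) := by
      simp only [Pi.smul_apply, ← Finset.smul_sum, sum_single (show 1 ≤ n by omega) le_rfl] at hz
      simp at hz
      push_cast
      linarith
    have hcint : c ∈ intSubgroup := hcz ▸ intCast_mem_intSubgroup (-z)
    have hB : blockVec β.sum l k ∈ intSubgroup :=
      (blockVec_mem_coordLattice (n := n) (by omega)).1 k
    simpa using add_mem (hd.1 k) (mul_mem_intSubgroup hcint hB)

theorem coordFills_classRep_iff (hn : 1 ≤ n) (hp : IsPartitionPair n β γ) :
    CoordFills n (classRep (signedSwap n) n β γ) ↔ (∃ l ∈ β, Odd l) ∧ γ.length ≤ 1 := by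
  refine ⟨fun h => ⟨exists_odd_of_coordFills hn hp h, length_le_one_of_coordFills hp h⟩, ?_⟩
  rintro ⟨⟨l, hl, hodd⟩, hγ⟩ f hf0 hf
  have hs := hp.sum_eq
  obtain ⟨g, hg, hgf⟩ := exists_coordLattice_of_length_le_one hp hγ hf0 hf
  obtain ⟨y, hy⟩ : ∑ k ∈ Finset.Ioc 0 n, g k ∈ intSubgroup := sum_mem fun k _ => hg.1 k
  rcases Int.even_or_odd' y with ⟨z, rfl | rfl⟩
  · exact ⟨g, ⟨hg, z, by rw [← hy]; simp⟩, hgf⟩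
  -- The parity of the sum is corrected by a fixed vector, the indicator of an odd positive cycle.
  · obtain ⟨i, -, hi, hfix⟩ := exists_posProd_fixed_blockVec hp.pos_left (n := n) (j := 0)
      (by omega) hl
    obtain ⟨m, rfl⟩ := hodd
    refine ⟨g + blockVec i (2 * m + 1), ⟨add_mem hg (blockVec_mem_coordLattice (by omega)),
      z + m + 1, ?_⟩, ?_⟩
    · simp only [Pi.add_apply, Finset.sum_add_distrib, ← hy,
        sum_blockVec (show i + (2 * m + 1) ≤ n by omega)]
      simp
      ring
    · rw [map_add, classRep_eq_self_of_posProd_fixed hp hfix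
        fun k hk => blockVec_eq_zero (by omega), ← hgf]
      abel

end Criterion

/-! ### Coordinates on the space of coroots -/

section Transfer

variable {ι M N : Type*} [AddCommGroup M] [Module ℝ M] [AddCommGroup N] [Module ℝ N]
  {P : RootPairing ι ℝ M N} [P.IsRootSystem] {b : P.Base} {n : ℕ}

lemma rootForm_corootVec (i j : Fin n) :
    rootForm n (i + 1) (corootVec n (j + 1)) = (CartanMatrix.B n i j : ℝ) := by
  have hcoroot : ∀ m k, corootVec n m k =
      if k = m then if m = n then 2 else 1 else if k = m + 1 ∧ m ≠ n then -1 else 0 := by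
    intro m k
    rw [corootVec]
    by_cases hm : m = n
    · by_cases hk : k = n <;> simp [hm, hk]
    · by_cases hk : k = m
      · simp [hm, hk]
      · by_cases hk' : k = m + 1 <;> simp [hm, hk, hk']
  have hi := i.isLt
  have hj := j.isLt
  simp only [rootForm_apply, hcoroot, CartanMatrix.B, Matrix.of_apply, Fin.ext_iff]
  split_ifs <;> first | (exfalso; omega) | norm_num

/-- The coordinates of the space of coroots in which the simple coroots are `ε_i - ε_{i+1}` and
`2 ε_n`. -/
noncomputable def coordMap (e : Fin n ≃ b.support) : N →ₗ[ℝ] (ℕ → ℝ) :=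
  (b.toCoweightBasis.reindex e.symm).constr ℝ fun i : Fin n => corootVec n (i + 1)

variable {e : Fin n ≃ b.support}

lemma coordMap_coroot (i : Fin n) : coordMap e (P.coroot (e i)) = corootVec n (i + 1) := by
  have : P.coroot (e i) = (b.toCoweightBasis.reindex e.symm) i := by simp
  rw [this, coordMap, Module.Basis.constr_basis]

lemma coordMap_mem_evenLattice {v : N} (hv : v ∈ corootLattice P fun i => (e i : ι)) :
    coordMap e v ∈ evenLattice n := by
  induction hv using Submodule.span_induction with
  | mem x hx =>
    obtain ⟨i, rfl⟩ := hx
    rw [coordMap_coroot]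
    exact corootVec_mem_evenLattice (by omega) (by omega)
  | zero => rw [map_zero]; exact zero_mem _
  | add x y _ _ hx hy => rw [map_add]; exact add_mem hx hy
  | smul z x _ hx => rw [map_zsmul]; exact zsmul_mem hx z

lemma coordMap_apply_eq_zero (v : N) {k : ℕ} (hk : ¬(0 < k ∧ k ≤ n)) : coordMap e v k = 0 := by
  have : LinearMap.proj k ∘ₗ coordMap e = (0 : N →ₗ[ℝ] ℝ) := by
    refine (b.toCoweightBasis.reindex e.symm).ext fun j => ?_
    have hj : (b.toCoweightBasis.reindex e.symm) j = P.coroot (e j) := by simp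
    rw [hj, LinearMap.comp_apply, coordMap_coroot]
    exact (corootVec_mem_evenLattice (by omega) (by omega)).1.2 k hk
  exact LinearMap.congr_fun this v

lemma exists_coordMap_eq_single_sub {i : ℕ} (h1 : 1 ≤ i) (h2 : i ≤ n) :
    ∃ v ∈ corootLattice P fun i => (e i : ι),
      coordMap e v = Pi.single i 1 - Pi.single n 1 := by
  induction h2 using Nat.decreasingInduction with
  | self => exact ⟨0, zero_mem _, by simp⟩
  | of_succ i hi ih =>
    obtain ⟨v, hv, hvi⟩ := ih (by omega)
    refine ⟨P.coroot (e ⟨i - 1, by omega⟩) + v,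
      add_mem (Submodule.subset_span ⟨_, rfl⟩) hv, ?_⟩
    rw [map_add, coordMap_coroot, hvi, corootVec, if_neg (by simp; omega)]
    simp [Nat.sub_add_cancel h1]

/-- A vector of `ℝ^n` in terms of the differences `ε_k - ε_n` and of the coroot `2 ε_n`. The
coefficient of the latter is half the sum of the entries, an integer on the even lattice. -/
lemma eq_sum_smul_single_sub_add {f : ℕ → ℝ} (hf : ∀ k, ¬(0 < k ∧ k ≤ n) → f k = 0) :
    f = ∑ k ∈ Finset.Ioc 0 n, f k • (Pi.single k 1 - Pi.single n 1 : ℕ → ℝ) +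
      ((∑ k ∈ Finset.Ioc 0 n, f k) / 2) • ((2 : ℝ) • (Pi.single n 1 : ℕ → ℝ)) := by
  simp only [smul_sub, Finset.sum_sub_distrib, ← Finset.sum_smul]
  rw [smul_smul, div_mul_cancel₀ _ (two_ne_zero), sub_add_cancel]
  ext i
  rw [Finset.sum_apply]
  simp only [Pi.smul_apply, Pi.single_apply, smul_eq_mul, mul_ite, mul_one, mul_zero]
  rw [Finset.sum_ite_eq]
  split_ifs with h
  · rfl
  · exact hf i (by simpa using h)

lemma exists_coordMap_eq (hn : 1 ≤ n) {f : ℕ → ℝ} (hf : ∀ k, ¬(0 < k ∧ k ≤ n) → f k = 0) :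
    ∃ v, coordMap e v = f := by
  change f ∈ LinearMap.range (coordMap e)
  rw [eq_sum_smul_single_sub_add hf]
  refine add_mem (Submodule.sum_mem _ fun k hk => Submodule.smul_mem _ _ ?_)
    (Submodule.smul_mem _ _ ⟨P.coroot (e ⟨n - 1, by omega⟩), ?_⟩)
  · rw [Finset.mem_Ioc] at hk
    obtain ⟨v, -, hv⟩ := exists_coordMap_eq_single_sub (e := e) hk.1 hk.2
    exact ⟨v, hv⟩
  · rw [coordMap_coroot, corootVec, if_pos (Nat.sub_add_cancel hn)]

lemma exists_mem_corootLattice_of_mem_evenLattice (hn : 1 ≤ n) {f : ℕ → ℝ}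
    (hf : f ∈ evenLattice n) :
    ∃ v ∈ corootLattice P fun i => (e i : ι), coordMap e v = f := by
  change f ∈ (corootLattice P fun i => (e i : ι)).toAddSubgroup.map (coordMap e).toAddMonoidHom
  obtain ⟨⟨hi, h0⟩, z, hz⟩ := hf
  rw [eq_sum_smul_single_sub_add h0]
  refine add_mem (sum_mem fun k hk => ?_) ?_
  · obtain ⟨y, hy⟩ := hi k
    rw [Finset.mem_Ioc] at hk
    obtain ⟨v, hv, hvk⟩ := exists_coordMap_eq_single_sub (e := e) hk.1 hk.2
    refine ⟨y • v, Submodule.smul_mem _ _ hv, ?_⟩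
    rw [← hy, ← hvk]
    simp [Int.cast_smul_eq_zsmul]
  · refine ⟨z • P.coroot (e ⟨n - 1, by omega⟩),
      Submodule.smul_mem _ _ (Submodule.subset_span ⟨_, rfl⟩), ?_⟩
    have : coordMap e (P.coroot (e ⟨n - 1, by omega⟩)) = (2 : ℝ) • Pi.single n 1 := by
      rw [coordMap_coroot, corootVec, if_pos (Nat.sub_add_cancel hn)]
    rw [hz, mul_div_cancel_left₀ _ (two_ne_zero), ← this]
    simp [Int.cast_smul_eq_zsmul]

variable [P.IsCrystallographic]

lemma rootForm_coordMap
    (hB : ∀ i j : Fin n, b.cartanMatrix (e i) (e j) = CartanMatrix.B n i j) (i : Fin n) (v : N) :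
    rootForm n (i + 1) (coordMap e v) = P.root' (e i) v := by
  have : (rootForm n (i + 1)) ∘ₗ coordMap e = P.root' (e i) := by
    refine (b.toCoweightBasis.reindex e.symm).ext fun j => ?_
    have hj : (b.toCoweightBasis.reindex e.symm) j = P.coroot (e j) := by simp
    rw [hj, LinearMap.comp_apply, coordMap_coroot, rootForm_corootVec, ← hB]
    have := b.algebraMap_cartanMatrixIn_apply ℤ (e i) (e j)
    simpa using this
  rw [← this, LinearMap.comp_apply]

lemma coordMap_coreflection
    (hB : ∀ i j : Fin n, b.cartanMatrix (e i) (e j) = CartanMatrix.B n i j) (i : Fin n) (v : N) :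
    coordMap e (P.coreflection (e i) v) = signedSwap n (i + 1) (coordMap e v) := by
  rw [P.coreflection_apply, map_sub, map_smul, coordMap_coroot,
    signedSwap_apply_eq_sub (by omega) (by omega), rootForm_coordMap hB]

lemma coordMap_classRep
    (hB : ∀ i j : Fin n, b.cartanMatrix (e i) (e j) = CartanMatrix.B n i j) (β γ : List ℕ)
    (v : N) :
    coordMap e (((classRep (simpleReflection P fun i => (e i : ι)) n β γ :
      weylGroup P fun i => (e i : ι)) : N ≃ₗ[ℝ] N) v) =
      classRep (signedSwap n) n β γ (coordMap e v) := by
  let G := weylGroup P fun i => (e i : ι)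
  let G' := (ℕ → ℝ) ≃ₗ[ℝ] (ℕ → ℝ)
  let H : Submonoid (G × G') :=
    { carrier := {p | ∀ v, coordMap e ((p.1 : N ≃ₗ[ℝ] N) v) = p.2 (coordMap e v)}
      one_mem' := fun v => rfl
      mul_mem' := fun {p q} hp hq v => by
        change coordMap e ((p.1 : N ≃ₗ[ℝ] N) ((q.1 : N ≃ₗ[ℝ] N) v)) = _
        rw [hp, hq]
        rfl }
  let s : ℕ → G × G' := fun i => (simpleReflection P (fun i => (e i : ι)) i, signedSwap n i)
  have h : classRep s n β γ ∈ H := by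
    refine classRep_mem H (fun i v => ?_) n β γ
    by_cases hi : 1 ≤ i ∧ i ≤ n
    · have := coordMap_coreflection hB ⟨i - 1, by omega⟩ v
      simp only [Nat.sub_add_cancel hi.1] at this
      simpa [s, simpleReflection, hi] using this
    · simp only [s, simpleReflection, signedSwap, dif_neg hi, if_neg hi]
      rfl
  have h1 := map_classRep (MonoidHom.fst G G') s n β γ
  have h2 := map_classRep (MonoidHom.snd G G') s n β γ
  simp only [MonoidHom.coe_fst, MonoidHom.coe_snd] at h1 h2
  have := h v
  rw [h1, h2] at this
  exact this

lemma coordMap_injective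
    (hB : ∀ i j : Fin n, b.cartanMatrix (e i) (e j) = CartanMatrix.B n i j) :
    Function.Injective (coordMap e) := by
  refine (injective_iff_map_eq_zero _).mpr fun v hv => ?_
  -- A vector with zero coordinates is orthogonal to the simple roots, which span.
  have h : P.toLinearMap.flip v = 0 := by
    refine b.toWeightBasis.ext fun i => ?_
    have := rootForm_coordMap hB (e.symm i) v
    rw [hv, map_zero, e.apply_symm_apply] at this
    simpa using this.symm
  exact P.flip.toPerfPair.injective (by simpa using h)

lemma mem_corootLattice_iff (hn : 1 ≤ n)
    (hB : ∀ i j : Fin n, b.cartanMatrix (e i) (e j) = CartanMatrix.B n i j) {v : N} :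
    v ∈ corootLattice P (fun i => (e i : ι)) ↔ coordMap e v ∈ evenLattice n := by
  refine ⟨coordMap_mem_evenLattice, fun h => ?_⟩
  obtain ⟨u, hu, huv⟩ := exists_mem_corootLattice_of_mem_evenLattice (e := e) hn h
  exact coordMap_injective hB huv ▸ hu

/-! ### Filling the move-set in coordinates and under conjugation -/

lemma weylGroup_apply_mem_corootLattice
    (hB : ∀ i j : Fin n, b.cartanMatrix (e i) (e j) = CartanMatrix.B n i j)
    (w : weylGroup P fun i => (e i : ι)) {v : N}
    (hv : v ∈ corootLattice P fun i => (e i : ι)) :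
    (w : N ≃ₗ[ℝ] N) v ∈ corootLattice P fun i => (e i : ι) := by
  have hgen : ∀ (i : Fin n) (v : N), v ∈ corootLattice P (fun i => (e i : ι)) →
      P.coreflection (e i) v ∈ corootLattice P fun i => (e i : ι) := fun i v hv => by
    obtain ⟨z, hz⟩ : P.root' (e i) v ∈ intSubgroup :=
      rootForm_coordMap hB i v ▸ rootForm_mem_intSubgroup (coordMap_mem_evenLattice hv).1.1
    rw [P.coreflection_apply, ← hz]
    refine sub_mem hv ?_
    have hmem : P.coroot (e i) ∈ corootLattice P fun i => (e i : ι) :=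
      Submodule.subset_span ⟨i, rfl⟩
    simpa [Int.cast_smul_eq_zsmul] using Submodule.smul_mem _ z hmem
  have key : ∀ v, (w : N ≃ₗ[ℝ] N) v ∈ corootLattice P (fun i => (e i : ι)) ↔
      v ∈ corootLattice P fun i => (e i : ι) := by
    obtain ⟨w, hw⟩ := w
    induction hw using Subgroup.closure_induction with
    | mem x hx =>
      obtain ⟨i, rfl⟩ := hx
      exact fun v => ⟨fun h => P.coreflection_same (e i) v ▸ hgen i _ h, hgen i v⟩
    | one => exact fun v => Iff.rfl
    | mul x y _ _ hx hy => exact fun v => (hx _).trans (hy v)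
    | inv x _ hx =>
      exact fun v => (hx _).symm.trans (by simp)
  exact (key v).mpr hv

lemma fillsMoveSet_iff
    (hB : ∀ i j : Fin n, b.cartanMatrix (e i) (e j) = CartanMatrix.B n i j)
    (w : weylGroup P fun i => (e i : ι)) :
    FillsMoveSet P (fun i => (e i : ι)) w ↔
      ∀ q : N, (w : N ≃ₗ[ℝ] N) q - q ∈ corootLattice P (fun i => (e i : ι)) →
        ∃ q' ∈ corootLattice P (fun i => (e i : ι)),
          (w : N ≃ₗ[ℝ] N) q' - q' = (w : N ≃ₗ[ℝ] N) q - q := by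
  constructor
  · intro h q hq
    have : (w : N ≃ₗ[ℝ] N) q - q ∈ modSet P (fun i => (e i : ι)) w := by
      rw [h]
      exact ⟨⟨q, by abel⟩, hq⟩
    obtain ⟨q', hq', hqq⟩ := this
    exact ⟨q', hq', hqq.symm⟩
  · intro h
    ext p
    constructor
    · rintro ⟨q, hq, rfl⟩
      exact ⟨⟨q, by abel⟩, sub_mem (weylGroup_apply_mem_corootLattice hB w hq) hq⟩
    · rintro ⟨⟨q, hq⟩, hp⟩
      obtain rfl : p = (w : N ≃ₗ[ℝ] N) q - q := by rw [← hq]; abel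
      obtain ⟨q', hq', hqq⟩ := h q hp
      exact ⟨q', hq', hqq.symm⟩

lemma FillsMoveSet.of_isConj
    (hB : ∀ i j : Fin n, b.cartanMatrix (e i) (e j) = CartanMatrix.B n i j)
    {w w' : weylGroup P fun i => (e i : ι)} (hc : IsConj w w')
    (h : FillsMoveSet P (fun i => (e i : ι)) w) : FillsMoveSet P (fun i => (e i : ι)) w' := by
  obtain ⟨c, rfl⟩ := isConj_iff.mp hc
  rw [fillsMoveSet_iff hB] at h ⊢
  intro q hq
  have hcc : ∀ v, (c : N ≃ₗ[ℝ] N) (((c⁻¹ : weylGroup P fun i => (e i : ι)) : N ≃ₗ[ℝ] N) v) = v :=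
    fun v => by simp
  have hcc' : ∀ v, ((c⁻¹ : weylGroup P fun i => (e i : ι)) : N ≃ₗ[ℝ] N) ((c : N ≃ₗ[ℝ] N) v) = v :=
    fun v => by simp
  have hmul : ∀ v, ((c * w * c⁻¹ : weylGroup P fun i => (e i : ι)) : N ≃ₗ[ℝ] N) v =
      (c : N ≃ₗ[ℝ] N) ((w : N ≃ₗ[ℝ] N)
        (((c⁻¹ : weylGroup P fun i => (e i : ι)) : N ≃ₗ[ℝ] N) v)) := fun v => rfl
  have hq' := weylGroup_apply_mem_corootLattice hB c⁻¹ hq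
  rw [hmul, map_sub, hcc'] at hq'
  obtain ⟨r, hr, hrq⟩ := h _ hq'
  refine ⟨(c : N ≃ₗ[ℝ] N) r, weylGroup_apply_mem_corootLattice hB c hr, ?_⟩
  rw [hmul, hmul, hcc', ← map_sub, hrq, map_sub, hcc]

lemma fillsMoveSet_classRep_iff (hn : 1 ≤ n)
    (hB : ∀ i j : Fin n, b.cartanMatrix (e i) (e j) = CartanMatrix.B n i j) (β γ : List ℕ) :
    FillsMoveSet P (fun i => (e i : ι)) (classRep (simpleReflection P fun i => (e i : ι)) n β γ) ↔
      CoordFills n (classRep (signedSwap n) n β γ) := by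
  rw [fillsMoveSet_iff hB]
  constructor
  · intro h f hf0 hf
    obtain ⟨q, rfl⟩ := exists_coordMap_eq (e := e) hn hf0
    rw [← coordMap_classRep hB, ← map_sub, ← mem_corootLattice_iff hn hB] at hf
    obtain ⟨q', hq', hqq⟩ := h q hf
    refine ⟨coordMap e q', coordMap_mem_evenLattice hq', ?_⟩
    rw [← coordMap_classRep hB, ← map_sub, hqq, map_sub, coordMap_classRep hB]
  · intro h q hq
    rw [mem_corootLattice_iff hn hB, map_sub, coordMap_classRep hB] at hq
    obtain ⟨g, hg, hgq⟩ := h _ (fun k => coordMap_apply_eq_zero q) hq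
    obtain ⟨q', hq', rfl⟩ := exists_mem_corootLattice_of_mem_evenLattice (e := e) hn hg
    refine ⟨q', hq', coordMap_injective hB ?_⟩
    rw [map_sub, map_sub, coordMap_classRep hB, coordMap_classRep hB, hgq]

end Transfer

/-! ### The arithmetic form of the condition -/

lemma foldr_gcd_dvd {β : List ℕ} {l : ℕ} (hl : l ∈ β) : β.foldr Nat.gcd 0 ∣ l := by
  induction β with
  | nil => simp at hl
  | cons m β ih =>
    rcases List.mem_cons.mp hl with rfl | hl
    · exact Nat.gcd_dvd_left _ _
    · exact (Nat.gcd_dvd_right _ _).trans (ih hl)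

lemma dvd_foldr_gcd {β : List ℕ} {d : ℕ} (h : ∀ l ∈ β, d ∣ l) : d ∣ β.foldr Nat.gcd 0 := by
  induction β with
  | nil => simp
  | cons m β ih =>
    simp only [List.mem_cons, forall_eq_or_imp] at h
    exact Nat.dvd_gcd h.1 (ih h.2)

/-- The gcd of a list of numbers and its last entry minus `2` is the gcd of the list and `2`. -/
lemma gcd_foldr_getLastD_sub_two_eq_one_iff {β : List ℕ} (h : 2 ≤ β.getLastD 0) :
    Nat.gcd (β.foldr Nat.gcd 0) (β.getLastD 0 - 2) = 1 ↔ ∃ l ∈ β, Odd l := by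
  have hne : β ≠ [] := by rintro rfl; simp at h
  have hlast : β.getLastD 0 ∈ β := by
    rw [List.getLastD_eq_getLast?, List.getLast?_eq_some_getLast hne]
    exact List.getLast_mem hne
  constructor
  · intro h1
    by_contra! hodd
    have heven : ∀ l ∈ β, 2 ∣ l := fun l hl => (Nat.not_odd_iff_even.mp (hodd l hl)).two_dvd
    have := Nat.dvd_gcd (dvd_foldr_gcd heven) (Nat.dvd_sub (heven _ hlast) dvd_rfl)
    omega
  · rintro ⟨l, hl, hodd⟩
    set d := Nat.gcd (β.foldr Nat.gcd 0) (β.getLastD 0 - 2)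
    have h1 : ∀ m ∈ β, d ∣ m := fun m hm => (Nat.gcd_dvd_left _ _).trans (foldr_gcd_dvd hm)
    have h2 : d ∣ 2 := (Nat.dvd_sub_iff_right h (h1 _ hlast)).mp (Nat.gcd_dvd_right _ _)
    rcases (Nat.dvd_prime Nat.prime_two).mp h2 with hd | hd
    · exact hd
    · have := h1 l hl
      rw [hd] at this
      exact absurd (even_iff_two_dvd.mpr this) (Nat.not_even_iff_odd.mpr hodd)

lemma odd_part_and_length_le_one_iff {n : ℕ} {β γ : List ℕ}
    (hp : IsPartitionPair n β γ) :
    ((∃ l ∈ β, Odd l) ∧ γ.length ≤ 1) ↔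
      ((∃ k ∈ β, Odd k) ∧ γ.length = 1) ∨
      (2 ≤ β.getLastD 0 ∧ Nat.gcd (β.foldr Nat.gcd 0) (β.getLastD 0 - 2) = 1 ∧ γ.sum = 0) ∨
      (β.getLastD 0 = 1 ∧ γ.sum = 0) := by
  have hγ : γ.sum = 0 ↔ γ.length = 0 := by
    cases γ with
    | nil => simp
    | cons a γ =>
      have := hp.pos_right a (by simp)
      simp
      omega
  have hlast : β ≠ [] → β.getLastD 0 ∈ β := fun hne => by
    rw [List.getLastD_eq_getLast?, List.getLast?_eq_some_getLast hne]
    exact List.getLast_mem hne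
  constructor
  · rintro ⟨hodd, hlen⟩
    rcases Nat.le_one_iff_eq_zero_or_eq_one.mp hlen with h0 | h1
    · right
      obtain ⟨l, hl, -⟩ := id hodd
      have hpos := hp.pos_left _ (hlast (List.ne_nil_of_mem hl))
      rcases hpos.eq_or_lt with h1 | h2
      · exact Or.inr ⟨h1.symm, hγ.mpr h0⟩
      · exact Or.inl ⟨h2, (gcd_foldr_getLastD_sub_two_eq_one_iff h2).mpr hodd, hγ.mpr h0⟩
    · exact Or.inl ⟨hodd, h1⟩
  · rintro (⟨hodd, h1⟩ | ⟨h2, hg, h0⟩ | ⟨h1, h0⟩)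
    · exact ⟨hodd, h1.le⟩
    · exact ⟨(gcd_foldr_getLastD_sub_two_eq_one_iff h2).mp hg, by rw [hγ.mp h0]; omega⟩
    · refine ⟨⟨_, hlast (by rintro rfl; simp at h1), ?_⟩, by rw [hγ.mp h0]; omega⟩
      rw [h1]
      exact odd_one

end FillB

theorem corollary1p9 {ι M N : Type*} [Finite ι] [AddCommGroup M] [Module ℝ M]
    [AddCommGroup N] [Module ℝ N]
    (P : RootPairing ι ℝ M N) [P.IsRootSystem] [P.IsCrystallographic] (b : P.Base)
    (n : ℕ) (hn : 2 ≤ n) (e : Fin n ≃ b.support)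
    (hB : ∀ i j : Fin n, b.cartanMatrix (e i) (e j) = CartanMatrix.B n i j)
    (w : FillB.weylGroup P fun i => (e i : ι)) (β γ : List ℕ)
    (hw : FillB.ClassIndexedBy P (fun i => (e i : ι)) w β γ) :
    FillB.FillsMoveSet P (fun i => (e i : ι)) w ↔
      ((∃ k ∈ β, Odd k) ∧ γ.length = 1) ∨
      (2 ≤ β.getLastD 0 ∧ Nat.gcd (β.foldr Nat.gcd 0) (β.getLastD 0 - 2) = 1 ∧ γ.sum = 0) ∨
      (β.getLastD 0 = 1 ∧ γ.sum = 0) := by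
  rw [← FillB.odd_part_and_length_le_one_iff hw.1,
    ← FillB.coordFills_classRep_iff (by omega) hw.1,
    ← FillB.fillsMoveSet_classRep_iff (e := e) (by omega) hB]
  exact ⟨.of_isConj hB hw.2, .of_isConj hB hw.2.symm⟩
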